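/- Let $\mathcal{M}\subset\mathbb{C}$ be a finite constellation, $\mathcal M\not\subseteq\{0\}$, with $\sum_{x\in\mathcal{M}}x=0$ and $\sum_{x\in\mathcal{M}}x^2=0$ (the real and imaginary parts of a uniformly distributed symbol are uncorrelated and have equal variances, as for QPSK and square QAM), and let $\sigma_b^2=\frac{1}{|\mathcal{M}|}\sum_{x\in\mathcal{M}}|x|^2$. Let $L>1$ be the oversampling factor. For $\mathbf{c}\in\mathbb{C}^N$ let $$s(n,\mathbf{c})=\frac{1}{\sigma_b\sqrt{N}}\sum_{k=0}^{N-1}c_k\,e^{i\frac{2\pi}{LN}kn},\qquad 0\le n<LN,$$ be the discrete-time OFDM symbol. For $0\le j<N$ and decided signs $x_0^\ast,\dots,x_{j-1}^\ast\in\{-1,1\}$ put $$\mathbf{Y}_j^\pm=[x_0^\ast,\dots,x_{j-1}^\ast,\pm1,X_{j+1},\dots,X_{N-1}]^T,$$ where $X_{j+1},\dots,X_{N-1}$ are independent and uniformly distributed on $\{-1,1\}$, and for $\mathbf{b}\in\mathcal{M}^N$ put $$\mu_r(n,\mathbf{b}\odot\mathbf{Y}_j^\pm)+i\,\mu_i(n,\mathbf{b}\odot\mathbf{Y}_j^\pm)=\frac{1}{\sigma_b\sqrt{N}}\Big(\pm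 b_j e^{i\frac{2\pi}{LN}jn}+\sum_{k=0}^{j-1}b_k x_k^\ast e^{i\frac{2\pi}{LN}kn}\Big),$$ with $\mu_r,\mu_i$ real and $\odot$ the element-wise product. For each $N$ let $\mathbf{B}^{(N)}$ be uniformly distributed on $\mathcal{M}^N$, the vectors $\mathbf{B}^{(N)}$, $N\ge1$, being defined on one probability space with an arbitrary joint distribution. Then with probability one the realizations $\mathbf{b}=\mathbf{b}^{(N)}$ of $\mathbf{B}^{(N)}$ have the following property. Let $N\to\infty$ along any sequence and let $0\le j=j_N<N$ with $j/N\to\rho$ (in particular, $j=\rho N$ for a fixed rational $\rho\in[0,1)$ and $N$ running through values for which $\rho N$ is an integer). Then for either choice of the sign $\pm$, for any decided signs (which may depend on $\mathbf{b}$ and $N$), and for any sample index $n$ (fixed, or depending on $N$ with $0\le n<LN$), $$\begin{bmatrix}\mathrm{Re}\,s(n,\mathbf{b}\odot\mathbf{Y}_j^\pm)-\mu_r(n,\mathbf{b}\odot\mathbf{Y}_j^\pm)\\ \mathrm{Im}\,s(n,\mathbf{b}\odot\mathbf{Y}_j^\pm)-\mu_i(n,\mathbf{b}\odot\mathbf{Y}_j^\pm)\end{bmatrix}\xrightarrow{d}\mathcal{N}\Big(0,\tfrac12(1-\rho)I\Big),$$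 where $\mathbf b$ is fixed, the randomness is that of the signs $X_k$ only, $I$ is the $2\times2$ identity matrix, and the limit is the point mass at $0$ if $\rho=1$. -/

import Mathlib

open MeasureTheory ProbabilityTheory Filter Topology

noncomputable section

namespace OFDM

/-- The root mean square `σ_b` of a constellation `M`: `σ_b² = 𝔼|B|²` for a symbol `B` that is
uniformly distributed on `M`. For independent zero-mean symbols `B_k` this is also the power
`𝔼|N^{-1/2} ∑_k B_k e^{iω_k t}|²` of the OFDM symbol before normalization, at every time `t`. -/
def rms (M : Finset ℂ) : ℝ := Real.sqrt ((∑ x ∈ M, ‖x‖ ^ 2) / M.card)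

/-- The subcarrier sample `e^{i 2π k n / (L N)}`. -/
def carrier (L : ℝ) (N k n : ℕ) : ℂ :=
  Complex.exp (Complex.I * ((2 * Real.pi / (L * N) * k * n : ℝ) : ℂ))

/-- The discrete-time OFDM symbol
`s(n, c) = (1 / (σ √N)) ∑_{k=0}^{N-1} c_k e^{i 2π k n / (L N)}` of a data vector `c ∈ ℂ^N`. -/
def sample (σ L : ℝ) {N : ℕ} (n : ℕ) (c : Fin N → ℂ) : ℂ :=
  ((1 / (σ * Real.sqrt N) : ℝ) : ℂ) * ∑ k : Fin N, c k * carrier L N k n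

/-- The sign vector `Y = (x_0, …, x_{j-1}, ε, X_{j+1}, …, X_{N-1})`: decided signs before
position `j`, the sign `ε = ±1` at position `j`, and the signs `X` after position `j`. -/
def signVector {N : ℕ} (j : Fin N) (x : Fin N → ℝ) (ε : ℝ) (X : Fin N → ℝ) : Fin N → ℝ :=
  fun k => if k < j then x k else if k = j then ε else X k

/-- The element-wise product `b ⊙ y` of a data vector and a sign vector. -/
def flipSigns {N : ℕ} (b : Fin N → ℂ) (y : Fin N → ℝ) : Fin N → ℂ :=
  fun k => b k * (y k : ℂ)

/-- `(1 / (σ √N)) (ε b_j e^{i 2π j n / (L N)} + ∑_{k=0}^{j-1} b_k x_k e^{i 2π k n / (L N)})`,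
the complex number whose real and imaginary parts are the means `μ_r` and `μ_i`. -/
def sampleMean (σ L : ℝ) {N : ℕ} (n : ℕ) (b : Fin N → ℂ) (j : Fin N) (x : Fin N → ℝ) (ε : ℝ) :
    ℂ :=
  ((1 / (σ * Real.sqrt N) : ℝ) : ℂ) *
    ((ε : ℂ) * b j * carrier L N j n + ∑ k ∈ Finset.Iio j, b k * (x k : ℂ) * carrier L N k n)

end OFDM

end

/-! Once `b` is fixed, the centred sample is `∑ w_k X_k` with independent signs and `w_k = b_k
e^{iθ_k} / (σ √N)` for `k > j`, zero otherwise. Its characteristic function at `t` is `∏ cos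
(t·w_k)`, which differs from `exp (-½ ∑ (t·w_k)²)` by at most `2 ∑ (t·w_k)⁴`. The Gaussian limit
therefore follows from `∑ |w_k|² → 1 - ρ`, `∑ w_k² → 0` and `∑ |w_k|⁴ → 0`
(`tendstoInDistribution_sum_signs`). The last is automatic, since `|w_k| = O(N^{-1/2})`.

The first two require the sums of `|b_k|² - σ²` and of `b_k² e^{2iθ_k}` over `k > j` to be `o(N)`.
Both summands have mean zero over a uniform symbol, the second because `∑ x² = 0`, whatever the
carrier. Hoeffding's inequality, a union bound over the `O(N²)` pairs `(j, n)` and Borel–Cantelli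
give this almost surely and uniformly in `(j, n)` (`ae_eventually_norm_sum_lt`). Hence one null set
serves all choices of `j` and `n`, while the decided signs cancel with the mean. -/

theorem integral_uniformOn_finset {α E : Type*} [MeasurableSpace α] [MeasurableSingletonClass α]
    [NormedAddCommGroup E] [NormedSpace ℝ E] [CompleteSpace E] (s : Finset α) (f : α → E) :
    ∫ x, f x ∂(uniformOn (s : Set α)) = (s.card : ℝ)⁻¹ • ∑ x ∈ s, f x := by
  rw [uniformOn, ProbabilityTheory.cond, integral_smul_measure,
    setIntegral_finset _ ?_]
  · simp [measureReal_def]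
  · rw [IntegrableOn]
    have : IsFiniteMeasure ((Measure.count : Measure α).restrict (s : Set α)) :=
      ⟨by simp [Measure.count_apply_finset]⟩
    refine Integrable.mono' (g := fun _ => ∑ x ∈ s, ‖f x‖) (integrable_const _) ?_ ?_
    · refine ⟨fun y => ∑ x ∈ s, ({x} : Set α).indicator f y, ?_, ?_⟩
      · refine Finset.stronglyMeasurable_fun_sum _ fun x _ => ?_
        have : ({x} : Set α).indicator f = ({x} : Set α).indicator (fun _ => f x) := by
          ext y; by_cases h : y = x <;> simp [h]
        rw [this]
        exact stronglyMeasurable_const.indicator (measurableSet_singleton x)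
      · filter_upwards [ae_restrict_mem s.measurableSet] with y hy
        rw [Finset.sum_eq_single y]
        · simp
        · intro b _ hb; simp [hb.symm]
        · intro h; exact absurd hy h
    · filter_upwards [ae_restrict_mem s.measurableSet] with y hy
      exact Finset.single_le_sum (f := fun x => ‖f x‖) (fun _ _ => norm_nonneg _) hy

/-! ### Products of cosines and the central limit theorem for signs. -/

theorem abs_prod_sub_prod_le {ι : Type*} (s : Finset ι) (f g : ι → ℝ)
    (hf : ∀ i ∈ s, |f i| ≤ 1) (hg : ∀ i ∈ s, |g i| ≤ 1) :
    |∏ i ∈ s, f i - ∏ i ∈ s, g i| ≤ ∑ i ∈ s, |f i - g i| := by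
  classical
  induction s using Finset.induction_on with
  | empty => simp
  | insert a s ha ih =>
    rw [Finset.prod_insert ha, Finset.prod_insert ha, Finset.sum_insert ha]
    have ih' := ih (fun i hi => hf i (Finset.mem_insert_of_mem hi))
      (fun i hi => hg i (Finset.mem_insert_of_mem hi))
    have h1 : |∏ i ∈ s, f i| ≤ 1 := by
      rw [Finset.abs_prod]
      exact Finset.prod_le_one (fun _ _ => abs_nonneg _)
        (fun i hi => hf i (Finset.mem_insert_of_mem hi))
    have h2 := hg a (Finset.mem_insert_self a s)
    calc |f a * ∏ i ∈ s, f i - g a * ∏ i ∈ s, g i|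
        = |(f a - g a) * ∏ i ∈ s, f i + g a * (∏ i ∈ s, f i - ∏ i ∈ s, g i)| := by ring_nf
      _ ≤ |f a - g a| * |∏ i ∈ s, f i| + |g a| * |∏ i ∈ s, f i - ∏ i ∈ s, g i| := by
          rw [← abs_mul, ← abs_mul]; exact abs_add_le _ _
      _ ≤ |f a - g a| * 1 + 1 * |∏ i ∈ s, f i - ∏ i ∈ s, g i| := by gcongr
      _ ≤ _ := by linarith

/-- Both functions are `1 - a²/2 + O(a⁴)` when `|a| ≤ 1`; otherwise the trivial bound `2` suffices.
-/
theorem abs_cos_sub_exp_le (a : ℝ) : |Real.cos a - Real.exp (-(a ^ 2 / 2))| ≤ 2 * a ^ 4 := by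
  rcases le_total |a| 1 with h | h
  · have ha : a ^ 2 ≤ 1 := by simpa using (sq_le_one_iff_abs_le_one a).2 h
    have h1 := Real.cos_bound h
    have h2 : |Real.exp (-(a ^ 2 / 2)) - 1 - (-(a ^ 2 / 2))| ≤ (-(a ^ 2 / 2)) ^ 2 :=
      Real.abs_exp_sub_one_sub_id_le (by rw [abs_neg, abs_of_nonneg (by positivity)]; linarith)
    have h3 : |a| ^ 4 = a ^ 4 := by rw [← abs_pow, abs_of_nonneg (by positivity)]
    rw [h3] at h1
    have h4 : 0 ≤ a ^ 4 := by positivity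
    rw [abs_le] at *
    constructor <;> nlinarith
  · have h1 := Real.abs_cos_le_one a
    have h2 : Real.exp (-(a ^ 2 / 2)) ≤ 1 := Real.exp_le_one_iff.2 (by nlinarith [sq_nonneg a])
    have h3 := Real.exp_pos (-(a ^ 2 / 2))
    have h4 : 1 ≤ a ^ 4 := by
      have : 1 ≤ |a| ^ 4 := one_le_pow₀ h
      rwa [← abs_pow, abs_of_nonneg (by positivity)] at this
    rw [abs_le] at *
    constructor <;> linarith

theorem abs_prod_cos_sub_exp_le {ι : Type*} (s : Finset ι) (a : ι → ℝ) :
    |∏ i ∈ s, Real.cos (a i) - Real.exp (-((∑ i ∈ s, a i ^ 2) / 2))| ≤ 2 * ∑ i ∈ s, a i ^ 4 := by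
  have : Real.exp (-((∑ i ∈ s, a i ^ 2) / 2)) = ∏ i ∈ s, Real.exp (-(a i ^ 2 / 2)) := by
    rw [← Real.exp_sum, Finset.sum_div, Finset.sum_neg_distrib]
  rw [this, Finset.mul_sum]
  refine (abs_prod_sub_prod_le s _ _ (fun i _ => Real.abs_cos_le_one _) fun i _ => ?_).trans
    (Finset.sum_le_sum fun i _ => abs_cos_sub_exp_le _)
  rw [abs_of_pos (Real.exp_pos _)]
  exact Real.exp_le_one_iff.2 (by nlinarith [sq_nonneg (a i)])

/-- Argument `1` loses nothing: the frequency is absorbed into the coefficients `a`. -/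
theorem charFun_map_sum_signs {ι Ω : Type*} [Fintype ι] [MeasurableSpace Ω] {P : Measure Ω}
    {X : ι → Ω → ℝ} (hlaw : ∀ k, HasLaw (X k) (uniformOn ({1, -1} : Set ℝ)) P)
    (hind : iIndepFun X P) (a : ι → ℝ) :
    charFun (P.map fun ω => ∑ k, a k * X k ω) 1 = ((∏ k, Real.cos (a k) : ℝ) : ℂ) := by
  have hm : ∀ k, AEMeasurable (fun ω => a k * X k ω) P :=
    fun k => (hlaw k).aemeasurable.const_mul _
  have hi : iIndepFun (fun k ω => a k * X k ω) P :=
    hind.comp (fun k x => a k * x) fun k => measurable_const_mul _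
  rw [hi.charFun_map_fun_sum_eq_prod hm, Finset.prod_apply, Complex.ofReal_prod]
  refine Finset.prod_congr rfl fun k _ => ?_
  rw [charFun_apply_real, integral_map (hm k) (by fun_prop)]
  have h := (hlaw k).integral_comp (f := fun x : ℝ => Complex.exp ((1 : ℝ) * (a k * x : ℝ) * Complex.I))
    (by fun_prop)
  rw [Function.comp_def] at h
  rw [h, show ({1, -1} : Set ℝ) = (({1, -1} : Finset ℝ) : Set ℝ) by simp,
    integral_uniformOn_finset, Finset.sum_pair (by norm_num), Finset.card_pair (by norm_num)]
  rw [Complex.ofReal_cos, Complex.cos]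
  simp
  ring

/-- Central limit theorem for complex combinations of independent signs under a Lyapunov
condition, when the limit is a circularly symmetric Gaussian. -/
theorem tendstoInDistribution_sum_signs {ι : ℕ → Type*} [∀ m, Fintype (ι m)]
    {Ω : Type*} [MeasurableSpace Ω] {P : Measure Ω} [IsProbabilityMeasure P]
    {X : (m : ℕ) → ι m → Ω → ℝ}
    (hlaw : ∀ m k, HasLaw (X m k) (uniformOn ({1, -1} : Set ℝ)) P)
    (hind : ∀ m, iIndepFun (X m) P) (w : (m : ℕ) → ι m → ℂ) {v : ℝ} (hv : 0 ≤ v)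
    (h2 : Tendsto (fun m => ∑ k, ‖w m k‖ ^ 2) atTop (𝓝 v))
    (hsq : Tendsto (fun m => ∑ k, w m k ^ 2) atTop (𝓝 0))
    (h4 : Tendsto (fun m => ∑ k, ‖w m k‖ ^ 4) atTop (𝓝 0)) :
    TendstoInDistribution
      (fun m ω => (!₂[(∑ k, w m k * (X m k ω : ℂ)).re, (∑ k, w m k * (X m k ω : ℂ)).im] :
        EuclideanSpace ℝ (Fin 2))) atTop id (fun _ => P)
      (multivariateGaussian 0 (((1 / 2) * v) • (1 : Matrix (Fin 2) (Fin 2) ℝ))) := by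
  have hmeas : ∀ m, AEMeasurable (fun ω => (!₂[(∑ k, w m k * (X m k ω : ℂ)).re,
      (∑ k, w m k * (X m k ω : ℂ)).im] : EuclideanSpace ℝ (Fin 2))) P := by
    intro m
    have hX : ∀ k, AEMeasurable (X m k) P := fun k => (hlaw m k).aemeasurable
    have hs : AEMeasurable (fun ω => ∑ k, w m k * (X m k ω : ℂ)) P :=
      Finset.aemeasurable_fun_sum _ fun k _ =>
        (Complex.measurable_ofReal.comp_aemeasurable (hX k)).const_mul _
    have hc : Measurable fun z : ℂ => (!₂[z.re, z.im] : EuclideanSpace ℝ (Fin 2)) := by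
      apply Continuous.measurable
      refine (PiLp.continuous_toLp 2 _).comp (continuous_pi fun i => ?_)
      fin_cases i
      · exact Complex.continuous_re
      · exact Complex.continuous_im
    exact hc.comp_aemeasurable hs
  refine ⟨hmeas, by fun_prop, ?_⟩
  refine ProbabilityMeasure.tendsto_iff_tendsto_charFun.2 fun t => ?_
  have hpos : (((1 / 2) * v) • (1 : Matrix (Fin 2) (Fin 2) ℝ)).PosSemidef :=
    Matrix.PosSemidef.one.smul (by positivity)
  simp only [ProbabilityMeasure.coe_mk, Measure.map_id]
  rw [charFun_multivariateGaussian hpos]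
  set a : (m : ℕ) → ι m → ℝ := fun m k => t 0 * (w m k).re + t 1 * (w m k).im with ha
  have hchar : ∀ m, charFun (P.map fun ω => (!₂[(∑ k, w m k * (X m k ω : ℂ)).re,
      (∑ k, w m k * (X m k ω : ℂ)).im] : EuclideanSpace ℝ (Fin 2))) t
        = ((∏ k, Real.cos (a m k) : ℝ) : ℂ) := by
    intro m
    rw [← charFun_map_sum_signs (hlaw m) (hind m), charFun_apply, integral_map (hmeas m)
      (by fun_prop), charFun_apply_real, integral_map ?_ (by fun_prop)]
    · congr 1 with ω
      congr 2
      rw [PiLp.inner_apply]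
      simp only [Fin.sum_univ_two, ha, add_mul, Finset.sum_add_distrib]
      simp [Finset.mul_sum, mul_assoc, mul_comm]
    · exact Finset.aemeasurable_fun_sum _ fun k _ => (hlaw m k).aemeasurable.const_mul _
  simp_rw [hchar]
  -- The quadratic form splits into an isotropic part and a part linear in `∑ w²`; the latter
  -- vanishes in the limit, so the covariance is a multiple of `I`.
  have hsum : ∀ m, ∑ k, a m k ^ 2 = (t 0 ^ 2 + t 1 ^ 2) / 2 * ∑ k, ‖w m k‖ ^ 2
      + (t 0 ^ 2 - t 1 ^ 2) / 2 * (∑ k, w m k ^ 2).re + t 0 * t 1 * (∑ k, w m k ^ 2).im := by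
    intro m
    rw [Complex.re_sum, Complex.im_sum, Finset.mul_sum, Finset.mul_sum, Finset.mul_sum,
      ← Finset.sum_add_distrib, ← Finset.sum_add_distrib]
    refine Finset.sum_congr rfl fun k _ => ?_
    rw [Complex.sq_norm, Complex.normSq_apply]
    simp only [ha, sq, Complex.mul_re, Complex.mul_im]
    ring
  have hsq2 : Tendsto (fun m => ∑ k, a m k ^ 2) atTop (𝓝 ((t 0 ^ 2 + t 1 ^ 2) / 2 * v)) := by
    simp_rw [hsum]
    have hre := (Complex.continuous_re.tendsto 0).comp hsq
    have him := (Complex.continuous_im.tendsto 0).comp hsq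
    simpa [Function.comp_def] using ((h2.const_mul ((t 0 ^ 2 + t 1 ^ 2) / 2)).add
      (hre.const_mul ((t 0 ^ 2 - t 1 ^ 2) / 2))).add (him.const_mul (t 0 * t 1))
  have hfour : Tendsto (fun m => 2 * ∑ k, a m k ^ 4) atTop (𝓝 0) := by
    have hb := h4.const_mul (2 * (t 0 ^ 2 + t 1 ^ 2) ^ 2)
    rw [mul_zero] at hb
    refine squeeze_zero (fun m => mul_nonneg zero_le_two
      (Finset.sum_nonneg fun k _ => by positivity)) (fun m => ?_) hb
    rw [mul_assoc]
    refine mul_le_mul_of_nonneg_left ?_ zero_le_two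
    rw [Finset.mul_sum]
    refine Finset.sum_le_sum fun k _ => ?_
    -- Cauchy–Schwarz, via Lagrange's identity.
    have h1 : a m k ^ 2 ≤ (t 0 ^ 2 + t 1 ^ 2) * ‖w m k‖ ^ 2 := by
      rw [Complex.sq_norm, Complex.normSq_apply]
      simp only [ha]
      nlinarith [sq_nonneg (t 0 * (w m k).im - t 1 * (w m k).re)]
    calc a m k ^ 4 = (a m k ^ 2) ^ 2 := by ring
      _ ≤ ((t 0 ^ 2 + t 1 ^ 2) * ‖w m k‖ ^ 2) ^ 2 := by gcongr
      _ = _ := by ring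
  have hexp : Tendsto (fun m => Real.exp (-((∑ k, a m k ^ 2) / 2))) atTop
      (𝓝 (Real.exp (-((t 0 ^ 2 + t 1 ^ 2) / 2 * v / 2)))) :=
    (Real.continuous_exp.tendsto _).comp (hsq2.div_const 2).neg
  have hprod : Tendsto (fun m => ∏ k, Real.cos (a m k)) atTop
      (𝓝 (Real.exp (-((t 0 ^ 2 + t 1 ^ 2) / 2 * v / 2)))) := by
    have hd : Tendsto (fun m => ∏ k, Real.cos (a m k) - Real.exp (-((∑ k, a m k ^ 2) / 2))) atTop
        (𝓝 0) := squeeze_zero_norm (fun m => abs_prod_cos_sub_exp_le _ _) hfour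
    simpa using hd.add hexp
  have hlim := (Complex.continuous_ofReal.tendsto _).comp hprod
  rw [Function.comp_def] at hlim
  convert hlim using 2
  rw [Complex.ofReal_exp]
  congr 1
  simp [Matrix.smul_mulVec, dotProduct, Fin.sum_univ_two]
  ring

/-! ### Concentration of sums of random symbols. -/

theorem ae_mem_of_hasLaw_uniformOn {Ω α : Type*} [MeasurableSpace Ω] [MeasurableSpace α]
    [MeasurableSingletonClass α] {P : Measure Ω} {M : Finset α} {Y : Ω → α}
    (h : HasLaw Y (uniformOn (M : Set α)) P) : ∀ᵐ ω ∂P, Y ω ∈ M := by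
  have : ∀ᵐ x ∂(uniformOn (M : Set α)), x ∈ M := ae_cond_mem M.measurableSet
  rw [← h.map_eq] at this
  exact ae_of_ae_map h.aemeasurable this

/-- Hoeffding's inequality for functions of independent symbols. -/
theorem measureReal_sum_ge_le {Ω : Type*} [MeasurableSpace Ω] {P : Measure Ω}
    [IsProbabilityMeasure P] {M : Finset ℂ} {N : ℕ} {B : Fin N → Ω → ℂ}
    (hlaw : ∀ k, HasLaw (B k) (uniformOn (M : Set ℂ)) P) (hind : iIndepFun B P)
    {f : Fin N → ℂ → ℝ} (hf : ∀ k, Measurable (f k)) {R : ℝ} (hR : 0 < R)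
    (hb : ∀ k, ∀ x ∈ M, |f k x| ≤ R) (h0 : ∀ k, ∑ x ∈ M, f k x = 0) {δ : ℝ} (hδ : 0 ≤ δ) :
    P.real {ω | δ * N ≤ ∑ k, f k (B k ω)} ≤ Real.exp (-(δ ^ 2 / (2 * R ^ 2)) * N) := by
  have hs : ∀ k ∈ Finset.univ, HasSubgaussianMGF (fun ω => f k (B k ω))
      ((‖R - (-R)‖₊ / 2) ^ 2) P := by
    intro k _
    refine hasSubgaussianMGF_of_mem_Icc_of_integral_eq_zero
      ((hf k).comp_aemeasurable (hlaw k).aemeasurable) ?_ ?_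
    · filter_upwards [ae_mem_of_hasLaw_uniformOn (hlaw k)] with ω hω
      exact abs_le.1 (hb k _ hω)
    · have := (hlaw k).integral_comp (hf k).aestronglyMeasurable
      rw [Function.comp_def] at this
      rw [this, integral_uniformOn_finset, h0, smul_zero]
  have hi : iIndepFun (fun k ω => f k (B k ω)) P := hind.comp f hf
  refine (HasSubgaussianMGF.measure_sum_ge_le_of_iIndepFun hi hs
    (ε := δ * N) (by positivity)).trans (Real.exp_le_exp.2 (le_of_eq ?_))
  have hc : (((‖R - (-R)‖₊ / 2) ^ 2 : NNReal) : ℝ) = R ^ 2 := by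
    push_cast
    rw [Real.norm_eq_abs, div_pow, sq_abs]
    ring
  rw [Finset.sum_const, Finset.card_univ, Fintype.card_fin, nsmul_eq_mul]
  push_cast at hc ⊢
  rw [hc]
  rcases Nat.eq_zero_or_pos N with rfl | hN
  · simp
  · have : (0 : ℝ) < N := by exact_mod_cast hN
    field_simp

/-- Since `|z| ≤ |Re z| + |Im z|`, one of `±Re`, `±Im` must reach `δN/2`: hence the factor `4`, and
`8` in place of `2` in the exponent. -/
theorem measureReal_norm_sum_ge_le {Ω : Type*} [MeasurableSpace Ω] {P : Measure Ω}
    [IsProbabilityMeasure P] {M : Finset ℂ} {N : ℕ} {B : Fin N → Ω → ℂ}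
    (hlaw : ∀ k, HasLaw (B k) (uniformOn (M : Set ℂ)) P) (hind : iIndepFun B P)
    {f : Fin N → ℂ → ℂ} (hf : ∀ k, Measurable (f k)) {R : ℝ} (hR : 0 < R)
    (hb : ∀ k, ∀ x ∈ M, ‖f k x‖ ≤ R) (h0 : ∀ k, ∑ x ∈ M, f k x = 0) {δ : ℝ} (hδ : 0 ≤ δ) :
    P.real {ω | δ * N ≤ ‖∑ k, f k (B k ω)‖} ≤ 4 * Real.exp (-(δ ^ 2 / (8 * R ^ 2)) * N) := by
  have key : ∀ g : ℂ → ℝ, Measurable g → (∀ z, |g z| ≤ ‖z‖) →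
      (∀ k, ∑ x ∈ M, g (f k x) = 0) →
      P.real {ω | δ / 2 * N ≤ ∑ k, g (f k (B k ω))} ≤
        Real.exp (-(δ ^ 2 / (8 * R ^ 2)) * N) := by
    intro g hg hle hg0
    have h := measureReal_sum_ge_le hlaw hind (f := fun k x => g (f k x))
      (fun k => hg.comp (hf k)) hR (fun k x hx => (hle _).trans (hb k x hx)) hg0
      (δ := δ / 2) (by positivity)
    convert h using 3
    ring
  have h1 := key Complex.re Complex.measurable_re Complex.abs_re_le_norm
    fun k => by rw [← Complex.re_sum, h0, Complex.zero_re]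
  have h2 := key (fun z => -z.re) Complex.measurable_re.neg
    (fun z => by rw [abs_neg]; exact Complex.abs_re_le_norm z)
    fun k => by rw [Finset.sum_neg_distrib, ← Complex.re_sum, h0, Complex.zero_re, neg_zero]
  have h3 := key Complex.im Complex.measurable_im Complex.abs_im_le_norm
    fun k => by rw [← Complex.im_sum, h0, Complex.zero_im]
  have h4 := key (fun z => -z.im) Complex.measurable_im.neg
    (fun z => by rw [abs_neg]; exact Complex.abs_im_le_norm z)
    fun k => by rw [Finset.sum_neg_distrib, ← Complex.im_sum, h0, Complex.zero_im, neg_zero]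
  have hsub : {ω | δ * N ≤ ‖∑ k, f k (B k ω)‖} ⊆
      ({ω | δ / 2 * N ≤ ∑ k, (f k (B k ω)).re} ∪ {ω | δ / 2 * N ≤ ∑ k, -(f k (B k ω)).re}) ∪
      ({ω | δ / 2 * N ≤ ∑ k, (f k (B k ω)).im} ∪ {ω | δ / 2 * N ≤ ∑ k, -(f k (B k ω)).im}) := by
    intro ω hω
    simp only [Set.mem_ofPred_eq, Set.mem_union, Finset.sum_neg_distrib, ← Complex.re_sum,
      ← Complex.im_sum] at hω ⊢
    by_contra! hc
    obtain ⟨⟨ha, hb⟩, hc, hd⟩ := hc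
    have := Complex.norm_le_abs_re_add_abs_im (∑ k, f k (B k ω))
    have e1 := abs_lt.2 ⟨by linarith, ha⟩
    have e2 := abs_lt.2 ⟨by linarith, hc⟩
    linarith
  refine (measureReal_mono hsub).trans ?_
  refine (measureReal_union_le _ _).trans ?_
  have u1 := measureReal_union_le (μ := P) {ω | δ / 2 * N ≤ ∑ k, (f k (B k ω)).re}
    {ω | δ / 2 * N ≤ ∑ k, -(f k (B k ω)).re}
  have u2 := measureReal_union_le (μ := P) {ω | δ / 2 * N ≤ ∑ k, (f k (B k ω)).im}
    {ω | δ / 2 * N ≤ ∑ k, -(f k (B k ω)).im}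
  linarith

/-- A uniform strong law for weighted sums of centered functions of independent symbols, over
polynomially many families of weights. -/
theorem ae_eventually_norm_sum_lt {Ω : Type*} [MeasurableSpace Ω] {P : Measure Ω}
    [IsProbabilityMeasure P] {M : Finset ℂ} {B : (N : ℕ) → Fin N → Ω → ℂ}
    (hlaw : ∀ N k, HasLaw (B N k) (uniformOn (M : Set ℂ)) P) (hind : ∀ N, iIndepFun (B N) P)
    {h : ℂ → ℂ} (hh : Measurable h) (h0 : ∑ x ∈ M, h x = 0)
    {ι : ℕ → Type*} [∀ N, Fintype (ι N)] {K : ℝ}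
    (hK : ∀ N, (Fintype.card (ι N) : ℝ) ≤ K * (N : ℝ) ^ 2)
    (c : (N : ℕ) → ι N → Fin N → ℂ) (hc : ∀ N i k, ‖c N i k‖ ≤ 1) :
    ∀ᵐ ω ∂P, ∀ δ > 0, ∀ᶠ N in atTop, ∀ i, ‖∑ k, c N i k * h (B N k ω)‖ < δ * N := by
  have main : ∀ δ : ℝ, 0 < δ → ∀ᵐ ω ∂P, ∀ᶠ N in atTop, ∀ i,
      ‖∑ k, c N i k * h (B N k ω)‖ < δ * N := by
    intro δ hδ
    -- The `+ 1` keeps `R` positive even if `h` vanishes on `M`.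
    set R : ℝ := (∑ x ∈ M, ‖h x‖) + 1 with hRdef
    have hR : 0 < R := by positivity
    set r : ℝ := δ ^ 2 / (8 * R ^ 2) with hr
    have hrpos : 0 < r := by positivity
    have hbad : ∀ N, P.real (⋃ i, {ω | δ * N ≤ ‖∑ k, c N i k * h (B N k ω)‖}) ≤
        4 * K * ((N : ℝ) ^ 2 * Real.exp (-r * N)) := by
      intro N
      refine (measureReal_iUnion_fintype_le _).trans ?_
      calc ∑ i, P.real {ω | δ * N ≤ ‖∑ k, c N i k * h (B N k ω)‖}
          ≤ ∑ _i : ι N, 4 * Real.exp (-r * N) := by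
            refine Finset.sum_le_sum fun i _ => ?_
            refine measureReal_norm_sum_ge_le (hlaw N) (hind N) (f := fun k x => c N i k * h x)
              (fun k => hh.const_mul _) hR (fun k x hx => ?_) (fun k => ?_) hδ.le
            · rw [norm_mul]
              have h1 : ‖h x‖ ≤ ∑ x ∈ M, ‖h x‖ :=
                Finset.single_le_sum (f := fun x => ‖h x‖) (fun _ _ => norm_nonneg _) hx
              nlinarith [hc N i k, norm_nonneg (h x)]
            · rw [← Finset.mul_sum, h0, mul_zero]
        _ = Fintype.card (ι N) * (4 * Real.exp (-r * N)) := by simp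
        _ ≤ K * (N : ℝ) ^ 2 * (4 * Real.exp (-r * N)) := by gcongr; exact hK N
        _ = _ := by ring
    have hsum : Summable fun N : ℕ => P.real (⋃ i, {ω | δ * N ≤ ‖∑ k, c N i k * h (B N k ω)‖}) :=
      Summable.of_nonneg_of_le (fun _ => measureReal_nonneg) hbad
        ((Real.summable_pow_mul_exp_neg_nat_mul 2 hrpos).mul_left _)
    have htop : ∑' N : ℕ, P (⋃ i, {ω | δ * N ≤ ‖∑ k, c N i k * h (B N k ω)‖}) ≠ ⊤ := by
      have := hsum.tsum_ofReal_ne_top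
      simpa only [ofReal_measureReal (measure_ne_top P _)] using this
    -- The first Borel–Cantelli lemma needs no independence between different `N`, so the joint law
    -- of the vectors is arbitrary.
    filter_upwards [ae_eventually_notMem htop] with ω hω
    filter_upwards [hω] with N hN i
    simp only [Set.mem_iUnion, Set.mem_ofPred_eq, not_exists, not_le] at hN
    exact hN i
  -- Countably many thresholds suffice to move `∀ δ` inside the almost-sure statement.
  have hall : ∀ᵐ ω ∂P, ∀ p : ℕ, ∀ᶠ N in atTop, ∀ i,
      ‖∑ k, c N i k * h (B N k ω)‖ < 1 / ((p : ℝ) + 1) * N :=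
    ae_all_iff.2 fun p => main _ (by positivity)
  filter_upwards [hall] with ω hω δ hδ
  obtain ⟨p, hp⟩ := exists_nat_one_div_lt hδ
  filter_upwards [hω p] with N hN i
  exact (hN i).trans_le (by gcongr)

/-! ### The OFDM sample as a sum of signs, and its moments. -/

namespace OFDM

theorem norm_carrier (L : ℝ) (N k n : ℕ) : ‖carrier L N k n‖ = 1 := by
  rw [carrier, Complex.norm_exp_I_mul_ofReal]

theorem rms_sq (M : Finset ℂ) : rms M ^ 2 = (∑ x ∈ M, ‖x‖ ^ 2) / M.card :=
  Real.sq_sqrt (by positivity)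

theorem rms_pos {M : Finset ℂ} (hM : ∃ x ∈ M, x ≠ 0) : 0 < rms M := by
  obtain ⟨x, hx, hx0⟩ := hM
  refine Real.sqrt_pos.2 (div_pos ?_ (by exact_mod_cast Finset.card_pos.2 ⟨x, hx⟩))
  exact Finset.sum_pos' (fun _ _ => by positivity) ⟨x, hx, by positivity⟩

/-- The coefficient of the random sign `X_k` in the sample `s(n, b ⊙ Y_j)`. -/
noncomputable def coeff (σ L : ℝ) {N : ℕ} (n : ℕ) (b : Fin N → ℂ) (j k : Fin N) : ℂ :=
  if j < k then ((1 / (σ * Real.sqrt N) : ℝ) : ℂ) * (b k * carrier L N k n) else 0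

theorem sample_sub_sampleMean (σ L : ℝ) {N : ℕ} (n : ℕ) (b : Fin N → ℂ) (j : Fin N)
    (x : Fin N → ℝ) (ε : ℝ) (X : Fin N → ℝ) :
    sample σ L n (flipSigns b (signVector j x ε X)) - sampleMean σ L n b j x ε =
      ∑ k, coeff σ L n b j k * (X k : ℂ) := by
  have hj : (ε : ℂ) * b j * carrier L N j n =
      ∑ k : Fin N, if k = j then (ε : ℂ) * b k * carrier L N k n else 0 := by simp
  have hlt : ∑ k ∈ Finset.Iio j, b k * (x k : ℂ) * carrier L N k n =
      ∑ k : Fin N, if k < j then b k * (x k : ℂ) * carrier L N k n else 0 := by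
    rw [← Finset.sum_filter]
    congr 1
    ext; simp
  rw [sample, sampleMean, ← mul_sub, hj, hlt, ← Finset.sum_add_distrib, ← Finset.sum_sub_distrib,
    Finset.mul_sum]
  refine Finset.sum_congr rfl fun k _ => ?_
  rcases lt_trichotomy k j with h | h | h
  · simp [coeff, flipSigns, signVector, h, h.ne, h.not_gt]
  · subst h
    simp [coeff, flipSigns, signVector, mul_comm]
  · simp [coeff, flipSigns, signVector, h, h.ne', h.not_gt]
    ring

theorem norm_coeff_le {σ : ℝ} (hσ : 0 < σ) (L : ℝ) {N : ℕ} (n : ℕ) (b : Fin N → ℂ) (j k : Fin N) :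
    ‖coeff σ L n b j k‖ ≤ ‖b k‖ / (σ * Real.sqrt N) := by
  rw [coeff]
  split_ifs
  · rw [norm_mul, norm_mul, norm_carrier, Complex.norm_real, Real.norm_of_nonneg (by positivity)]
    exact le_of_eq (by ring)
  · rw [norm_zero]; positivity

theorem sum_norm_coeff_sq {σ : ℝ} (hσ : 0 < σ) (L : ℝ) {N : ℕ} (n : ℕ) (b : Fin N → ℂ)
    (j : Fin N) :
    ∑ k, ‖coeff σ L n b j k‖ ^ 2 =
      1 / σ ^ 2 * ((∑ k, (if j < k then 1 else 0) * (((‖b k‖ ^ 2 - σ ^ 2 : ℝ)) : ℂ)) / N : ℂ).re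
        + (1 - (j : ℕ) / (N : ℝ) - 1 / N) := by
  have hN : (0 : ℝ) < N := by exact_mod_cast j.pos
  -- Exactly `N - 1 - j` signs are still random: position `j` itself is set to `ε`.
  have hcard : (1 - (j : ℕ) / (N : ℝ) - 1 / N) = (∑ k : Fin N, if j < k then (1 : ℝ) else 0) / N := by
    have h1 : (∑ k : Fin N, if j < k then (1 : ℝ) else 0) = ((N - 1 - j : ℕ) : ℝ) := by
      rw [Finset.sum_boole, ← Fin.card_Ioi]
      congr 2
      ext; simp
    have h2 : ((N - 1 - j : ℕ) : ℝ) = N - 1 - (j : ℕ) := by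
      have := j.2
      rw [Nat.cast_sub (by omega), Nat.cast_sub (by omega), Nat.cast_one]
    rw [h1, h2]
    field_simp
    ring
  have hre : ((∑ k, (if j < k then 1 else 0) * (((‖b k‖ ^ 2 - σ ^ 2 : ℝ)) : ℂ)) / N : ℂ).re =
      (∑ k, if j < k then ‖b k‖ ^ 2 - σ ^ 2 else 0) / N := by
    rw [Complex.div_natCast_re, Complex.re_sum]
    congr 1
    refine Finset.sum_congr rfl fun k _ => ?_
    split_ifs
    · rw [one_mul, Complex.ofReal_re]
    · simp
  rw [hre, hcard, Finset.sum_div, Finset.mul_sum, Finset.sum_div, ← Finset.sum_add_distrib]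
  refine Finset.sum_congr rfl fun k _ => ?_
  rw [coeff]
  split_ifs
  · rw [norm_mul, norm_mul, norm_carrier, Complex.norm_real, Real.norm_of_nonneg (by positivity),
      mul_one, mul_pow, div_pow, mul_pow, Real.sq_sqrt hN.le]
    field_simp
    ring
  · simp

theorem sum_coeff_sq {σ : ℝ} (L : ℝ) {N : ℕ} (n : ℕ) (b : Fin N → ℂ) (j : Fin N) :
    ∑ k, coeff σ L n b j k ^ 2 = (1 / σ ^ 2 : ℝ) *
      ((∑ k, (if j < k then carrier L N k n ^ 2 else 0) * b k ^ 2) / N) := by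
  rw [Finset.sum_div, Finset.mul_sum]
  refine Finset.sum_congr rfl fun k _ => ?_
  rw [coeff]
  split_ifs
  · rw [mul_pow, ← Complex.ofReal_pow, div_pow, mul_pow, Real.sq_sqrt (Nat.cast_nonneg N)]
    push_cast
    ring
  · simp

theorem sum_norm_coeff_pow_four_le {σ : ℝ} (hσ : 0 < σ) (L : ℝ) {N : ℕ} (n : ℕ) (b : Fin N → ℂ)
    (j : Fin N) {R : ℝ} (hb : ∀ k, ‖b k‖ ≤ R) :
    ∑ k, ‖coeff σ L n b j k‖ ^ 4 ≤ R ^ 4 / σ ^ 4 * (N : ℝ)⁻¹ := by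
  have hN : (0 : ℝ) < N := by exact_mod_cast j.pos
  calc ∑ k, ‖coeff σ L n b j k‖ ^ 4 ≤ ∑ _k : Fin N, (R / (σ * Real.sqrt N)) ^ 4 := by
        refine Finset.sum_le_sum fun k _ => ?_
        have := (norm_coeff_le hσ L n b j k).trans
          (div_le_div_of_nonneg_right (hb k) (by positivity))
        gcongr
    _ = _ := by
        have h4 : Real.sqrt N ^ 4 = (N : ℝ) ^ 2 := by
          rw [show 4 = 2 * 2 by norm_num, pow_mul, Real.sq_sqrt hN.le]
        rw [Finset.sum_const, Finset.card_univ, Fintype.card_fin, nsmul_eq_mul, div_pow, mul_pow,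
          h4]
        field_simp

theorem card_index_le {L : ℝ} (hL : 0 ≤ L) (N : ℕ) :
    (Fintype.card (Fin N × Fin ⌈L * N⌉₊) : ℝ) ≤ (L + 1) * (N : ℝ) ^ 2 := by
  rw [Fintype.card_prod, Fintype.card_fin, Fintype.card_fin, Nat.cast_mul]
  rcases Nat.eq_zero_or_pos N with rfl | hN
  · simp
  · have h1 : (1 : ℝ) ≤ N := by exact_mod_cast hN
    have h2 := (Nat.ceil_lt_add_one (a := L * N) (by positivity)).le
    calc (N : ℝ) * ⌈L * N⌉₊ ≤ N * (L * N + N) := by gcongr; linarith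
      _ = _ := by ring

theorem tendsto_div_of_eventually_norm_lt {Z : ℕ → ℂ} {N : ℕ → ℕ}
    (h : ∀ δ > 0, ∀ᶠ m in atTop, ‖Z m‖ < δ * N m) :
    Tendsto (fun m => Z m / N m) atTop (𝓝 0) := by
  rw [Metric.tendsto_nhds]
  intro δ hδ
  filter_upwards [h δ hδ] with m hm
  -- The strict inequality in the hypothesis rules out `N m = 0`.
  have hN : (0 : ℝ) < N m := by
    have := (norm_nonneg _).trans_lt hm
    exact pos_of_mul_pos_right this hδ.le
  rw [dist_zero_right, norm_div, Complex.norm_natCast, div_lt_iff₀ hN]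
  exact hm

/-- Convergence for a single realization of the data vectors, under uniform bounds on the
second-order sums of the remaining symbols. -/
theorem tendstoInDistribution_sample_sub_sampleMean {σ : ℝ} (hσ : 0 < σ) {L R : ℝ}
    (b : (N : ℕ) → Fin N → ℂ) (hR : ∀ N k, ‖b N k‖ ≤ R)
    (hpow : ∀ δ > 0, ∀ᶠ N in atTop, ∀ i : Fin N × Fin ⌈L * N⌉₊,
      ‖∑ k, (if i.1 < k then 1 else 0) * (((‖b N k‖ ^ 2 - σ ^ 2 : ℝ)) : ℂ)‖ < δ * N)
    (hrot : ∀ δ > 0, ∀ᶠ N in atTop, ∀ i : Fin N × Fin ⌈L * N⌉₊,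
      ‖∑ k, (if i.1 < k then carrier L N k i.2 ^ 2 else 0) * b N k ^ 2‖ < δ * N)
    {Ω : Type*} [MeasurableSpace Ω] {P : Measure Ω} [IsProbabilityMeasure P]
    {X : (N : ℕ) → Fin N → Ω → ℝ}
    (hlaw : ∀ N k, HasLaw (X N k) (uniformOn ({1, -1} : Set ℝ)) P)
    (hind : ∀ N, iIndepFun (X N) P)
    {ρ : ℝ} {N : ℕ → ℕ} (j : (m : ℕ) → Fin (N m)) {n : ℕ → ℕ}
    (x : (m : ℕ) → Fin (N m) → ℝ) (ε : ℝ) (hN : Tendsto N atTop atTop)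
    (hj : Tendsto (fun m => ((j m : ℕ) : ℝ) / (N m : ℝ)) atTop (𝓝 ρ))
    (hn : ∀ᶠ m in atTop, (n m : ℝ) < L * N m) :
    TendstoInDistribution
      (fun (m : ℕ) (ω : Ω) =>
        let s := sample σ L (n m)
          (flipSigns (b (N m)) (signVector (j m) (x m) ε (fun k => X (N m) k ω)))
        let μ := sampleMean σ L (n m) (b (N m)) (j m) (x m) ε
        (!₂[s.re - μ.re, s.im - μ.im] : EuclideanSpace ℝ (Fin 2)))
      atTop id (fun _ => P)
      (multivariateGaussian 0 (((1 / 2) * (1 - ρ)) • (1 : Matrix (Fin 2) (Fin 2) ℝ))) := by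
  -- Needed for the limiting covariance to be positive semidefinite; `ρ = 1` is allowed.
  have hρ : 0 ≤ 1 - ρ := sub_nonneg.2 <| le_of_tendsto' hj fun m =>
    div_le_one_of_le₀ (by exact_mod_cast (j m).2.le) (Nat.cast_nonneg _)
  have hinv : Tendsto (fun m => ((N m : ℕ) : ℝ)⁻¹) atTop (𝓝 0) :=
    tendsto_inv_atTop_zero.comp (tendsto_natCast_atTop_atTop.comp hN)
  have h2 := tendsto_div_of_eventually_norm_lt (N := N)
    (Z := fun m => ∑ k, (if j m < k then 1 else 0) * (((‖b (N m) k‖ ^ 2 - σ ^ 2 : ℝ)) : ℂ)) <| by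
      intro δ hδ
      filter_upwards [hN.eventually (hpow δ hδ), hn] with m hm hnm
      -- For an integer `n`, `n < LN` means `n < ⌈LN⌉`, so `(j, n)` lies in the finite index set of
      -- the uniform bound.
      exact hm (j m, ⟨n m, Nat.lt_ceil.2 hnm⟩)
  have hs := tendsto_div_of_eventually_norm_lt (N := N)
    (Z := fun m => ∑ k, (if j m < k then carrier L (N m) k (n m) ^ 2 else 0) * b (N m) k ^ 2) <| by
      intro δ hδ
      filter_upwards [hN.eventually (hrot δ hδ), hn] with m hm hnm
      exact hm (j m, ⟨n m, Nat.lt_ceil.2 hnm⟩)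
  have key := tendstoInDistribution_sum_signs (fun m => hlaw (N m)) (fun m => hind (N m))
    (fun m => coeff σ L (n m) (b (N m)) (j m)) hρ ?_ ?_ ?_
  · convert key using 3 with m ω
    dsimp only
    rw [← Complex.sub_re, ← Complex.sub_im, sample_sub_sampleMean]
  · simp_rw [sum_norm_coeff_sq hσ]
    have hre := (Complex.continuous_re.tendsto 0).comp h2
    simpa [Function.comp_def] using
      (hre.const_mul (σ ^ 2)⁻¹).add ((hj.const_sub 1).sub hinv)
  · simp_rw [sum_coeff_sq]
    simpa using hs.const_mul ((σ : ℂ) ^ 2)⁻¹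
  · refine squeeze_zero (fun m => Finset.sum_nonneg fun k _ => by positivity)
      (fun m => sum_norm_coeff_pow_four_le hσ L (n m) (b (N m)) (j m) (hR (N m))) ?_
    simpa using hinv.const_mul (R ^ 4 / σ ^ 4)

end OFDM

theorem corollary1
    -- the constellation: zero mean, `∑ x² = 0` (real and imaginary parts of a uniform symbol
    -- are uncorrelated with equal variances), and not reduced to the point `0`
    (M : Finset ℂ) (hM0 : ∑ x ∈ M, x = 0) (hM2 : ∑ x ∈ M, x ^ 2 = 0) (hM : ∃ x ∈ M, x ≠ 0)
    -- the oversampling factor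
    (L : ℝ) (hL : 1 < L)
    -- for each `N`, a data vector `B N` uniformly distributed on `M ^ N`
    {Ω : Type*} [MeasurableSpace Ω] (P : Measure Ω) [IsProbabilityMeasure P]
    (B : (N : ℕ) → Fin N → Ω → ℂ)
    (hBlaw : ∀ N k, HasLaw (B N k) (uniformOn (M : Set ℂ)) P)
    (hBind : ∀ N, iIndepFun (B N) P)
    -- for each `N`, a vector `X N` of independent equiprobable random signs
    {Ω' : Type*} [MeasurableSpace Ω'] (P' : Measure Ω') [IsProbabilityMeasure P']
    (X : (N : ℕ) → Fin N → Ω' → ℝ)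
    (hXlaw : ∀ N k, HasLaw (X N k) (uniformOn ({1, -1} : Set ℝ)) P')
    (hXind : ∀ N, iIndepFun (X N) P') :
    -- for almost every realization `b N = (B N k ω)_k` of the data vectors
    ∀ᵐ ω ∂P,
      ∀ (ρ : ℝ) (N : ℕ → ℕ) (j : (m : ℕ) → Fin (N m)) (n : ℕ → ℕ)
        (x : (m : ℕ) → Fin (N m) → ℝ) (ε : ℝ),
        -- `N → ∞` with `j / N → ρ`, in particular with `j = ρ N`
        Tendsto N atTop atTop →
        Tendsto (fun m => ((j m : ℕ) : ℝ) / (N m : ℝ)) atTop (𝓝 ρ) →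
        -- `n` is a sample index, constant or varying with `N`
        (∀ᶠ m in atTop, (n m : ℝ) < L * N m) →
        -- `x` are the signs already decided, `ε` is the candidate sign at position `j`
        (∀ m k, x m k = 1 ∨ x m k = -1) →
        (ε = 1 ∨ ε = -1) →
        TendstoInDistribution
          (fun (m : ℕ) (ω' : Ω') =>
            let b : Fin (N m) → ℂ := fun k => B (N m) k ω
            let Y : Fin (N m) → ℝ := OFDM.signVector (j m) (x m) ε (fun k => X (N m) k ω')
            let s : ℂ := OFDM.sample (OFDM.rms M) L (n m) (OFDM.flipSigns b Y)
            let μ : ℂ := OFDM.sampleMean (OFDM.rms M) L (n m) b (j m) (x m) ε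
            (!₂[s.re - μ.re, s.im - μ.im] : EuclideanSpace ℝ (Fin 2)))
          atTop id (fun _ => P')
          (multivariateGaussian 0 (((1 / 2) * (1 - ρ)) • (1 : Matrix (Fin 2) (Fin 2) ℝ))) := by
  have hσ : 0 < OFDM.rms M := OFDM.rms_pos hM
  have hcard : (M.card : ℝ) ≠ 0 := by
    obtain ⟨x, hx, _⟩ := hM
    exact_mod_cast (Finset.card_pos.2 ⟨x, hx⟩).ne'
  have hpow := ae_eventually_norm_sum_lt hBlaw hBind
    (h := fun x => ((‖x‖ ^ 2 - OFDM.rms M ^ 2 : ℝ) : ℂ)) (by fun_prop)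
    (by
      rw [← Complex.ofReal_sum, Finset.sum_sub_distrib, Finset.sum_const, OFDM.rms_sq,
        nsmul_eq_mul, mul_div_cancel₀ _ hcard, sub_self, Complex.ofReal_zero])
    (OFDM.card_index_le (zero_le_one.trans hL.le))
    (fun N i k => if i.1 < k then 1 else 0) (fun N i k => by split_ifs <;> simp)
  have hrot := ae_eventually_norm_sum_lt hBlaw hBind (h := fun x => x ^ 2) (by fun_prop) hM2
    (OFDM.card_index_le (zero_le_one.trans hL.le))
    (fun N i k => if i.1 < k then OFDM.carrier L N k i.2 ^ 2 else 0)
    (fun N i k => by split_ifs <;> simp [OFDM.norm_carrier])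
  have hmem : ∀ᵐ ω ∂P, ∀ N k, B N k ω ∈ M :=
    ae_all_iff.2 fun N => ae_all_iff.2 fun k => ae_mem_of_hasLaw_uniformOn (hBlaw N k)
  filter_upwards [hpow, hrot, hmem] with ω h1 h2 h3
  intro ρ N j n x ε hN hj hn _ _
  exact OFDM.tendstoInDistribution_sample_sub_sampleMean hσ (fun N k => B N k ω)
    (R := ∑ x ∈ M, ‖x‖)
    (fun N k => Finset.single_le_sum (f := fun x => ‖x‖) (fun _ _ => norm_nonneg _) (h3 N k))
    h1 h2 hXlaw hXind j x ε hN hj hn
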